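/- Let $0<\sigma<1/2$. There exists a constant $C_\sigma$ depending on $\sigma$ only such that the following holds. Let $2=p_1<p_2<\cdots$ be the sequence of all primes, let $\pi(N)$ be the number of primes not exceeding $N$, and let $(\varepsilon_n)_{n\ge1}$ be a sequence of independent Rademacher random variables (${\bf P}\{\varepsilon_n=1\}={\bf P}\{\varepsilon_n=-1\}=1/2$). Let $N$ and $\nu$ be integers with $1\le\nu<\pi(N)$ and $\nu\le\big(\frac{N}{(\log N)\log\log N}\big)^{1/2}$, and let $K$ be a squarefree positive integer, all of whose prime divisors are at most $N$, which is divisible by every prime $p$ with $p_\nu<p\le N$ (and possibly by some of the primes $p\le p_\nu$). Then $$ {\bf E}\,\sup_{t\in{\bf R}}\Big|\sum_{2\le n\le N,\ (n,K)=1}\frac{\varepsilon_n}{n^{\sigma+it}}\Big| \le C_\sigma\,N^{1/2-\sigma}\,\max\Big(1,\sum_{k\le\nu,\ p_k\nmid K}\frac1{p_k}\Big)^{1/2}\,\sum_{k\le\nu,\ p_k\nmid K}\frac1{\sqrt{p_k}} . $$ -/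

import Mathlib

open MeasureTheory ProbabilityTheory

/-- The `k`-th prime number, counted from `k = 1`, so that `nthPrime 1 = 2`, `nthPrime 2 = 3`. -/
noncomputable def nthPrime (k : ℕ) : ℕ := Nat.nth Nat.Prime (k - 1)

/-- `(ε n)`, `n ≥ 1`, is a sequence of independent Rademacher random variables under `P`:
each `ε n` takes the values `1` and `-1` with probability `1/2`. Nothing is required of `ε 0`. -/
structure IsRademacherSeq {Ω : Type*} [MeasurableSpace Ω] (ε : ℕ → Ω → ℝ) (P : Measure Ω) :
    Prop where
  measurable : ∀ n : ℕ, 1 ≤ n → Measurable (ε n)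
  indep : iIndepFun (fun n : {n : ℕ // 1 ≤ n} => ε n) P
  prob_one : ∀ n : ℕ, 1 ≤ n → P {ω | ε n ω = 1} = 1 / 2
  prob_neg_one : ∀ n : ℕ, 1 ≤ n → P {ω | ε n ω = -1} = 1 / 2

/-- The set of integers `2 ≤ n ≤ N` that are coprime to `K`. -/
def coprimeSupport (N K : ℕ) : Finset ℕ := (Finset.Icc 2 N).filter (fun n => n.Coprime K)

/-- The Dirichlet polynomial `∑ e n * n ^ (-s)`, over the integers `2 ≤ n ≤ N` coprime to `K`. -/
noncomputable def dirichletPoly (e : ℕ → ℝ) (N K : ℕ) (s : ℂ) : ℂ :=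
  ∑ n ∈ coprimeSupport N K, (e n : ℂ) * (n : ℂ) ^ (-s)

/-- The indices `1 ≤ k ≤ ν` for which the `k`-th prime does not divide `K`. -/
noncomputable def freeIndices (ν K : ℕ) : Finset ℕ :=
  (Finset.Icc 1 ν).filter (fun k => ¬ nthPrime k ∣ K)

/-! Writing `m = ∏ p_j ^ a_j(m)` turns `m ^ (-it)` into a character of the torus at the point `x_j =
frac(-t log p_j / 2π)`, where `p_j` runs over the free primes (Bohr's lift,
`natCast_cpow_eq_torusCoeff`). The supremum over `t` is thus at most the supremum of a random
polynomial on a torus, and it suffices to control the metric of that subgaussian process.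

With `Q = N ^ (1 - 2σ) / (1 - 2σ)`, the weights `m ^ (-2σ)` of the multiples of `d` up to `N` have
sum at most `Q / d`. Valuations at different primes therefore behave as if independent, and
`sum_sq_sum_factorization_le` dominates the squared metric by a constant times `Q max(1, ∑ 1/p_j) ∑
δ_j² / p_j`: the process is no rougher than one on a box with sides `w_j = 1/√p_j`.

Chaining along grids with a different mesh in each dyadic block of coordinates bounds the supremum
on such a box by a multiple of `∑ w_j`, with no logarithmic loss (`sum_chainIncrement_le`,
`lintegral_iSup_torus_le`). The start of the chain costs the standard deviation at one point, at
most `√Q ∑ w_j`, because each integer in the support has a free prime factor. -/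

namespace IsRademacherSeq

/-! ### Rademacher sums and maximal inequalities. -/

variable {Ω : Type*} [MeasurableSpace Ω] {P : Measure Ω} {ε : ℕ → Ω → ℝ}

theorem ae_eq_one_or [IsProbabilityMeasure P] (h : IsRademacherSeq ε P) {n : ℕ} (hn : 1 ≤ n) :
    ∀ᵐ ω ∂P, ε n ω = 1 ∨ ε n ω = -1 := by
  have hm := h.measurable n hn
  have h1 : MeasurableSet {ω | ε n ω = 1} := hm (measurableSet_singleton 1)
  have h2 : MeasurableSet {ω | ε n ω = -1} := hm (measurableSet_singleton (-1))
  have hd : Disjoint {ω | ε n ω = 1} {ω | ε n ω = -1} := by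
    rw [Set.disjoint_left]
    intro ω (a : ε n ω = 1) (b : ε n ω = -1)
    linarith
  have hu : P ({ω | ε n ω = 1} ∪ {ω | ε n ω = -1}) = 1 := by
    rw [measure_union hd h2, h.prob_one n hn, h.prob_neg_one n hn]
    exact ENNReal.add_halves 1
  exact (prob_compl_eq_zero_iff (h1.union h2)).2 hu

theorem ae_forall_abs_eq_one [IsProbabilityMeasure P] (h : IsRademacherSeq ε P) (S : Finset ℕ)
    (hS : ∀ m ∈ S, 1 ≤ m) : ∀ᵐ ω ∂P, ∀ m ∈ S, |ε m ω| = 1 := by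
  rw [Finset.eventually_all]
  intro m hm
  filter_upwards [h.ae_eq_one_or (hS m hm)] with ω hω
  rcases hω with hω | hω <;> simp [hω]

theorem integral_eq_zero [IsProbabilityMeasure P] (h : IsRademacherSeq ε P) {n : ℕ}
    (hn : 1 ≤ n) : ∫ ω, ε n ω ∂P = 0 := by
  have hm := h.measurable n hn
  have h1 : MeasurableSet {ω | ε n ω = 1} := hm (measurableSet_singleton 1)
  have h2 : MeasurableSet {ω | ε n ω = -1} := hm (measurableSet_singleton (-1))
  have e : ε n =ᵐ[P] fun ω => {ω | ε n ω = 1}.indicator (fun _ => (1 : ℝ)) ω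
      - {ω | ε n ω = -1}.indicator (fun _ => (1 : ℝ)) ω := by
    filter_upwards [h.ae_eq_one_or hn] with ω hω
    rcases hω with hω | hω
    · simp [Set.indicator, hω]; norm_num
    · simp [Set.indicator, hω]; norm_num
  rw [integral_congr_ae e, integral_sub ((integrable_const _).indicator h1)
    ((integrable_const _).indicator h2), integral_indicator_const _ h1,
    integral_indicator_const _ h2]
  simp [Measure.real, h.prob_one n hn, h.prob_neg_one n hn]

theorem hasSubgaussianMGF [IsProbabilityMeasure P] (h : IsRademacherSeq ε P) {n : ℕ}
    (hn : 1 ≤ n) : HasSubgaussianMGF (ε n) 1 P := by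
  have := hasSubgaussianMGF_of_mem_Icc_of_integral_eq_zero (a := -1) (b := 1)
    (h.measurable n hn).aemeasurable
    (by
      filter_upwards [h.ae_eq_one_or hn] with ω hω
      rcases hω with hω | hω <;> simp [hω])
    (h.integral_eq_zero hn)
  convert this
  rw [← NNReal.coe_inj]
  norm_num

theorem hasSubgaussianMGF_sum [IsProbabilityMeasure P] (h : IsRademacherSeq ε P) (S : Finset ℕ)
    (hS : ∀ m ∈ S, 1 ≤ m) (b : ℕ → ℝ) :
    HasSubgaussianMGF (fun ω => ∑ m ∈ S, ε m ω * b m) (∑ m ∈ S, (b m ^ 2).toNNReal) P := by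
  have hind := h.indep.comp (fun n : {n : ℕ // 1 ≤ n} => fun x : ℝ => x * b n)
    (fun n => measurable_id.mul_const _)
  have := HasSubgaussianMGF.sum_of_iIndepFun hind
    (c := fun n : {n : ℕ // 1 ≤ n} => (b n ^ 2).toNNReal)
    (s := S.subtype (fun n => 1 ≤ n)) (by
      intro n _
      have := (h.hasSubgaussianMGF n.2).const_mul (b n)
      convert this using 1
      · ext ω; simp [mul_comm]
      · exact (Real.toNNReal_of_nonneg (sq_nonneg _)).trans (mul_one _).symm)
  have e1 : (∑ i ∈ S.subtype (fun n => 1 ≤ n), (b i ^ 2).toNNReal)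
      = ∑ m ∈ S, (b m ^ 2).toNNReal :=
    Finset.sum_subtype_of_mem (fun m => (b m ^ 2).toNNReal) hS
  rw [e1] at this
  refine this.congr (ae_of_all _ fun ω => ?_)
  exact Finset.sum_subtype_of_mem (fun m => ε m ω * b m) hS

/-- A maximal inequality for finitely many real Rademacher sums. -/
theorem exists_integrable_bound_real [IsProbabilityMeasure P] (h : IsRademacherSeq ε P)
    (S : Finset ℕ) (hS : ∀ m ∈ S, 1 ≤ m) {ι : Type*} (I : Finset ι) (b : ι → ℕ → ℝ) {D L : ℝ}
    (hD : 0 < D) (hL : 0 < L) (hb : ∀ i ∈ I, ∑ m ∈ S, b i m ^ 2 ≤ D ^ 2)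
    (hI : 2 * (I.card : ℝ) ≤ Real.exp L) :
    ∃ Z : Ω → ℝ, Integrable Z P ∧ ∫ ω, Z ω ∂P ≤ 3 / 2 * (√L * D) ∧
      ∀ ω, ∀ i ∈ I, |∑ m ∈ S, ε m ω * b i m| ≤ Z ω := by
  set Y : ι → Ω → ℝ := fun i ω => ∑ m ∈ S, ε m ω * b i m with hY
  -- With this `l`, each exponential moment is at most `exp (l² D² / 2) = exp (L / 2)`.
  set l : ℝ := √L / D with hl
  have hl0 : 0 < l := by positivity
  have hlD : l ^ 2 * D ^ 2 = L := by
    rw [hl, div_pow, Real.sq_sqrt hL.le]; field_simp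
  have hsub : ∀ i, HasSubgaussianMGF (Y i) (∑ m ∈ S, (b i m ^ 2).toNNReal) P :=
    fun i => h.hasSubgaussianMGF_sum S hS (b i)
  have hint : ∀ i, ∀ t : ℝ, Integrable (fun ω => Real.exp (t * Y i ω)) P :=
    fun i t => (hsub i).integrable_exp_mul t
  have hadd : ∀ i, Integrable (fun ω => Real.exp (l * Y i ω) + Real.exp (-l * Y i ω)) P :=
    fun i => (hint i l).add (hint i (-l))
  have hmgf : ∀ i ∈ I, ∀ t : ℝ, t ^ 2 = l ^ 2 →
      ∫ ω, Real.exp (t * Y i ω) ∂P ≤ Real.exp (L / 2) := by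
    intro i hi t ht
    refine ((hsub i).mgf_le t).trans (Real.exp_le_exp.2 ?_)
    have e : ((∑ m ∈ S, (b i m ^ 2).toNNReal : NNReal) : ℝ) = ∑ m ∈ S, b i m ^ 2 := by
      push_cast
      exact Finset.sum_congr rfl fun m _ => Real.coe_toNNReal _ (sq_nonneg _)
    rw [e, ht]
    have := mul_le_mul_of_nonneg_right (hb i hi) (sq_nonneg l)
    linarith
  -- This is `y ≤ 3L/2 - 1 + exp (y - 3L/2)` at `y = l |Y i|`, with the exponential replaced by a
  -- sum over all `i` and both signs. The shift `3L/2` makes the mean of the last term at most `exp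
  -- (-3L/2) * exp L * exp (L/2) = 1`.
  refine ⟨fun ω => 1 / l * ((3 / 2 * L - 1) + Real.exp (-(3 / 2 * L)) *
    ∑ i ∈ I, (Real.exp (l * Y i ω) + Real.exp (-l * Y i ω))), ?_, ?_, ?_⟩
  · exact (((integrable_const _).add ((integrable_finsetSum _ fun i _ => hadd i).const_mul _)).const_mul _)
  · have hS' : Integrable (fun ω => ∑ i ∈ I, (Real.exp (l * Y i ω) + Real.exp (-l * Y i ω))) P :=
      integrable_finsetSum _ fun i _ => hadd i
    rw [integral_const_mul, integral_add (integrable_const _) (hS'.const_mul _),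
      integral_const_mul, integral_finsetSum _ fun i _ => hadd i]
    have h1 : ∑ i ∈ I, ∫ ω, (Real.exp (l * Y i ω) + Real.exp (-l * Y i ω)) ∂P
        ≤ 2 * I.card * Real.exp (L / 2) := by
      calc _ ≤ ∑ i ∈ I, 2 * Real.exp (L / 2) := by
            refine Finset.sum_le_sum fun i hi => ?_
            rw [integral_add (hint i l) (hint i (-l))]
            have a1 := hmgf i hi l rfl
            have a2 := hmgf i hi (-l) (by ring)
            linarith
        _ = _ := by rw [Finset.sum_const, nsmul_eq_mul]; ring
    have h2 : Real.exp (-(3 / 2 * L)) * (2 * I.card * Real.exp (L / 2)) ≤ 1 := by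
      calc _ ≤ Real.exp (-(3 / 2 * L)) * (Real.exp L * Real.exp (L / 2)) := by gcongr
        _ = 1 := by
          rw [← Real.exp_add, ← Real.exp_add, ← Real.exp_zero]; congr 1; ring
    have h3 := mul_le_mul_of_nonneg_left h1 (Real.exp_pos (-(3 / 2 * L))).le
    have h4 : 3 / 2 * (√L * D) = 1 / l * (3 / 2 * L) := by
      rw [hl]
      field_simp
      rw [Real.sq_sqrt hL.le]
    rw [h4]
    refine mul_le_mul_of_nonneg_left ?_ (by positivity)
    simp only [integral_const, probReal_univ, smul_eq_mul, one_mul]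
    linarith
  · intro ω i hi
    have h1 : Real.exp (l * |Y i ω|) ≤ Real.exp (l * Y i ω) + Real.exp (-l * Y i ω) := by
      rcases abs_choice (Y i ω) with e | e <;> rw [e]
      · linarith [Real.exp_pos (-l * Y i ω)]
      · rw [mul_neg, ← neg_mul]; linarith [Real.exp_pos (l * Y i ω)]
    have h2 : Real.exp (l * Y i ω) + Real.exp (-l * Y i ω)
        ≤ ∑ i ∈ I, (Real.exp (l * Y i ω) + Real.exp (-l * Y i ω)) :=
      Finset.single_le_sum (f := fun i => Real.exp (l * Y i ω) + Real.exp (-l * Y i ω))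
        (fun j _ => by positivity) hi
    have h3 := mul_le_mul_of_nonneg_left (h1.trans h2) (Real.exp_pos (-(3 / 2 * L))).le
    rw [← Real.exp_add] at h3
    have h4 := Real.add_one_le_exp (-(3 / 2 * L) + l * |Y i ω|)
    have h5 : |Y i ω| = 1 / l * (l * |Y i ω|) := by field_simp
    change |Y i ω| ≤ _
    rw [h5]
    refine mul_le_mul_of_nonneg_left ?_ (by positivity)
    linarith

/-- A maximal inequality for finitely many complex Rademacher sums. -/
theorem exists_integrable_bound [IsProbabilityMeasure P] (h : IsRademacherSeq ε P)
    (S : Finset ℕ) (hS : ∀ m ∈ S, 1 ≤ m) {ι : Type*} (I : Finset ι) (v : ι → ℕ → ℂ) {D L : ℝ}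
    (hD : 0 < D) (hL : 0 < L) (hv : ∀ i ∈ I, ∑ m ∈ S, ‖v i m‖ ^ 2 ≤ D ^ 2)
    (hI : 2 * (I.card : ℝ) ≤ Real.exp L) :
    ∃ Z : Ω → ℝ, Integrable Z P ∧ ∫ ω, Z ω ∂P ≤ 3 * (√L * D) ∧
      ∀ ω, ∀ i ∈ I, ‖∑ m ∈ S, (ε m ω : ℂ) * v i m‖ ≤ Z ω := by
  obtain ⟨Z₁, i₁, e₁, b₁⟩ := h.exists_integrable_bound_real S hS I (fun i m => (v i m).re) hD hL
    (fun i hi => (Finset.sum_le_sum fun m _ => by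
      rw [← sq_abs]; gcongr; exact Complex.abs_re_le_norm _).trans (hv i hi)) hI
  obtain ⟨Z₂, i₂, e₂, b₂⟩ := h.exists_integrable_bound_real S hS I (fun i m => (v i m).im) hD hL
    (fun i hi => (Finset.sum_le_sum fun m _ => by
      rw [← sq_abs]; gcongr; exact Complex.abs_im_le_norm _).trans (hv i hi)) hI
  refine ⟨fun ω => Z₁ ω + Z₂ ω, i₁.add i₂, ?_, fun ω i hi => ?_⟩
  · rw [integral_add i₁ i₂]; linarith
  · refine (Complex.norm_le_abs_re_add_abs_im _).trans ?_
    have c₁ := b₁ ω i hi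
    have c₂ := b₂ ω i hi
    simp only [Complex.re_sum, Complex.im_sum, Complex.re_ofReal_mul, Complex.im_ofReal_mul]
    exact add_le_add c₁ c₂

end IsRademacherSeq

/-! ### Dyadic rounding in the unit interval. -/

/-- The largest multiple of `2 ^ (-m)` below the nonnegative number `x`. -/
noncomputable def dyadicFloor (m : ℕ) (x : ℝ) : ℝ := (⌊x * 2 ^ m⌋₊ : ℝ) / 2 ^ m

theorem dyadicFloor_zero_left {x : ℝ} (h1 : x < 1) : dyadicFloor 0 x = 0 := by
  have : ⌊x⌋₊ = 0 := Nat.floor_eq_zero.2 h1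
  simp [dyadicFloor, this]

theorem abs_sub_dyadicFloor_le (m : ℕ) {x : ℝ} (h0 : 0 ≤ x) :
    |x - dyadicFloor m x| ≤ (1 / 2) ^ m := by
  have hp : (0 : ℝ) < 2 ^ m := by positivity
  have h1 := Nat.floor_le (mul_nonneg h0 hp.le)
  have h2 := Nat.lt_floor_add_one (x * 2 ^ m)
  have e : x - dyadicFloor m x = (x * 2 ^ m - ⌊x * 2 ^ m⌋₊) / 2 ^ m := by
    unfold dyadicFloor; field_simp
  rw [e, abs_of_nonneg (by apply div_nonneg _ hp.le; linarith), one_div_pow]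
  gcongr
  linarith

theorem dyadicFloor_dyadicFloor {m k : ℕ} (hmk : m ≤ k) (x : ℝ) :
    dyadicFloor m (dyadicFloor k x) = dyadicFloor m x := by
  obtain ⟨d, rfl⟩ := Nat.exists_eq_add_of_le hmk
  unfold dyadicFloor
  have e : (⌊x * 2 ^ (m + d)⌋₊ : ℝ) / 2 ^ (m + d) * 2 ^ m
      = (⌊x * 2 ^ (m + d)⌋₊ : ℝ) / ((2 ^ d : ℕ) : ℝ) := by
    push_cast; rw [pow_add]; field_simp
  have e2 : x * 2 ^ m = x * 2 ^ (m + d) / ((2 ^ d : ℕ) : ℝ) := by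
    push_cast; rw [pow_add]; field_simp
  rw [e, e2, Nat.floor_div_natCast, Nat.floor_div_natCast, Nat.floor_natCast]

/-- The multiples of `2 ^ (-m)` in `[0, 1)`. -/
noncomputable def dyadicGrid (m : ℕ) : Finset ℝ :=
  (Finset.range (2 ^ m)).image fun k : ℕ => (k : ℝ) / 2 ^ m

theorem card_dyadicGrid_le (m : ℕ) : (dyadicGrid m).card ≤ 2 ^ m :=
  Finset.card_image_le.trans_eq (Finset.card_range _)

theorem dyadicFloor_mem_dyadicGrid (m : ℕ) {x : ℝ} (h1 : x < 1) :
    dyadicFloor m x ∈ dyadicGrid m := by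
  refine Finset.mem_image.2 ⟨⌊x * 2 ^ m⌋₊, Finset.mem_range.2 ?_, rfl⟩
  have hp : (0 : ℝ) < 2 ^ m := by positivity
  rw [Nat.floor_lt' (by positivity)]
  push_cast
  nlinarith

theorem nonneg_of_mem_dyadicGrid {m : ℕ} {x : ℝ} (h : x ∈ dyadicGrid m) : 0 ≤ x := by
  obtain ⟨k, -, rfl⟩ := Finset.mem_image.1 h
  positivity

theorem eq_zero_of_mem_dyadicGrid_zero {x : ℝ} (h : x ∈ dyadicGrid 0) : x = 0 := by
  obtain ⟨k, hk, rfl⟩ := Finset.mem_image.1 h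
  simp at hk
  simp [hk]

/-! ### Multiscale grids on the cube and the cost of a chain. -/

section Chaining

variable {n : ℕ}

/-- The index of the dyadic block `[2 ^ r, 2 ^ (r + 1))` that contains `j + 1`. -/
def dyadicBlock (j : ℕ) : ℕ := Nat.log 2 (j + 1)

theorem dyadicBlock_eq_iff {j r : ℕ} : dyadicBlock j = r ↔ 2 ^ r ≤ j + 1 ∧ j + 1 < 2 ^ (r + 1) := by
  unfold dyadicBlock
  rw [Nat.log_eq_iff (Or.inr ⟨one_lt_two, by omega⟩)]

theorem card_dyadicBlock_eq_le (r : ℕ) :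
    (Finset.univ.filter fun j : Fin n => dyadicBlock j = r).card ≤ 2 ^ r := by
  calc _ ≤ (Finset.Ico (2 ^ r) (2 ^ (r + 1))).card := by
        refine Finset.card_le_card_of_injOn (fun j => (j : ℕ) + 1) ?_ ?_
        · intro j hj
          have := dyadicBlock_eq_iff.1 (Finset.mem_filter.1 hj).2
          simpa using this
        · intro i _ j _ hij
          exact Fin.ext (by simpa using hij)
    _ = 2 ^ r := by rw [Nat.card_Ico, pow_succ]; omega

theorem card_dyadicBlock_le_le (s : ℕ) :
    (Finset.univ.filter fun j : Fin n => dyadicBlock j ≤ s).card ≤ 2 ^ (s + 1) := by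
  calc _ ≤ (Finset.range (2 ^ (s + 1))).card := by
        refine Finset.card_le_card_of_injOn (fun j => (j : ℕ)) ?_ ?_
        · intro j hj
          have h := (dyadicBlock_eq_iff.1 (rfl : dyadicBlock j = _)).2
          have h2 := (Finset.mem_filter.1 hj).2
          have h3 : 2 ^ (dyadicBlock j + 1) ≤ 2 ^ (s + 1) :=
            Nat.pow_le_pow_right two_pos (by omega)
          simp only [Finset.coe_range, Set.mem_Iio]
          omega
        · intro i _ j _ hij
          exact Fin.ext hij
    _ = _ := Finset.card_range _

/-- Passing from `s` to `s + 1` refines only the coordinates in blocks up to `s`, at most `2 ^ (s +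
1)` of them. So the entropy of the grid at level `s` is of order `2 ^ s`, whatever the dimension
`n`. -/
theorem sum_sub_dyadicBlock_le (s : ℕ) : ∑ j : Fin n, (s - dyadicBlock j) ≤ 2 ^ (s + 1) := by
  induction s with
  | zero => simp
  | succ s ih =>
    have e : ∀ j : Fin n, s + 1 - dyadicBlock j
        = (s - dyadicBlock j) + if dyadicBlock j ≤ s then 1 else 0 := by
      intro j; split_ifs <;> omega
    rw [Finset.sum_congr rfl fun j _ => e j, Finset.sum_add_distrib, ← Finset.card_filter,
      pow_succ 2 (s + 1)]
    have := card_dyadicBlock_le_le (n := n) s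
    omega

/-- The point `x` of the cube, with the coordinates in the `r`-th dyadic block rounded down to
multiples of `2 ^ (-(s - r))`. -/
noncomputable def roundLevel (s : ℕ) (x : Fin n → ℝ) : Fin n → ℝ :=
  fun j => dyadicFloor (s - dyadicBlock j) (x j)

/-- The points of the cube that are rounded at level `s`. -/
noncomputable def levelGrid (n s : ℕ) : Finset (Fin n → ℝ) :=
  Fintype.piFinset fun j => dyadicGrid (s - dyadicBlock j)

theorem card_levelGrid_le (s : ℕ) : (levelGrid n s).card ≤ 2 ^ 2 ^ (s + 1) := by
  rw [levelGrid, Fintype.card_piFinset]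
  calc _ ≤ ∏ j : Fin n, 2 ^ (s - dyadicBlock j) :=
        Finset.prod_le_prod' fun j _ => card_dyadicGrid_le _
    _ = 2 ^ ∑ j : Fin n, (s - dyadicBlock j) := Finset.prod_pow_eq_pow_sum _ _ _
    _ ≤ _ := Nat.pow_le_pow_right two_pos (sum_sub_dyadicBlock_le s)

/-- An exponent `5 * 2 ^ s` would do; `9` has an integer square root. -/
theorem two_mul_card_levelGrid_le (s : ℕ) :
    2 * ((levelGrid n (s + 1)).card : ℝ) ≤ Real.exp (9 * 2 ^ s) := by
  have h1 : ((levelGrid n (s + 1)).card : ℝ) ≤ 2 ^ 2 ^ (s + 2) := by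
    exact_mod_cast card_levelGrid_le (n := n) (s + 1)
  have h2 : (2 : ℝ) ≤ Real.exp 1 := by linarith [Real.add_one_le_exp (1 : ℝ)]
  have h3 : (1 : ℝ) ≤ 2 ^ s := one_le_pow₀ one_le_two
  calc 2 * ((levelGrid n (s + 1)).card : ℝ) ≤ 2 * 2 ^ 2 ^ (s + 2) := by gcongr
    _ = 2 ^ (2 ^ (s + 2) + 1) := by ring
    _ ≤ Real.exp 1 ^ (2 ^ (s + 2) + 1) := by gcongr
    _ = Real.exp (4 * 2 ^ s + 1) := by
        rw [← Real.exp_nat_mul]; congr 1; push_cast; ring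
    _ ≤ _ := Real.exp_le_exp.2 (by linarith)

theorem roundLevel_mem_levelGrid (s : ℕ) {x : Fin n → ℝ} (hx : ∀ j, x j < 1) :
    roundLevel s x ∈ levelGrid n s :=
  Fintype.mem_piFinset.2 fun j => dyadicFloor_mem_dyadicGrid _ (hx j)

theorem roundLevel_roundLevel_succ (s : ℕ) (x : Fin n → ℝ) :
    roundLevel s (roundLevel (s + 1) x) = roundLevel s x :=
  funext fun _ => dyadicFloor_dyadicFloor (by omega) _

theorem roundLevel_zero {x : Fin n → ℝ} (hx : ∀ j, x j < 1) : roundLevel 0 x = 0 := by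
  funext j
  simp only [roundLevel, Nat.zero_sub]
  exact dyadicFloor_zero_left (hx j)

/-- Beyond block `s` the truncated subtraction gives mesh `1` at both levels, so these coordinates
are already `0` and do not move. -/
theorem abs_sub_roundLevel_le_of_mem {s : ℕ} {x : Fin n → ℝ} (hx : x ∈ levelGrid n (s + 1))
    (j : Fin n) : |x j - roundLevel s x j|
      ≤ if dyadicBlock j ≤ s then (1 / 2) ^ (s - dyadicBlock j) else 0 := by
  have hj := Fintype.mem_piFinset.1 hx j
  split_ifs with h
  · exact abs_sub_dyadicFloor_le _ (nonneg_of_mem_dyadicGrid hj)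
  · have e1 : s + 1 - dyadicBlock j = 0 := by omega
    have e2 : s - dyadicBlock j = 0 := by omega
    rw [e1] at hj
    simp [roundLevel, e2, eq_zero_of_mem_dyadicGrid_zero hj, dyadicFloor]

theorem abs_sub_roundLevel_le (s : ℕ) {x : Fin n → ℝ} (hx : ∀ j, 0 ≤ x j) (j : Fin n) :
    |x j - roundLevel s x j| ≤ n * (1 / 2) ^ s := by
  refine (abs_sub_dyadicFloor_le _ (hx j)).trans ?_
  have h1 : 2 ^ dyadicBlock j ≤ (j : ℕ) + 1 := (dyadicBlock_eq_iff.1 rfl).1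
  have h2 : ((2 ^ dyadicBlock j : ℕ) : ℝ) ≤ n := by exact_mod_cast h1.trans j.2
  push_cast at h2
  calc ((1 : ℝ) / 2) ^ (s - dyadicBlock j)
      ≤ 2 ^ dyadicBlock j * (1 / 2) ^ s := by
        rw [← div_le_iff₀' (by positivity), div_eq_mul_inv, ← inv_pow, ← one_div, ← pow_add]
        exact pow_le_pow_of_le_one (by norm_num) (by norm_num) (by omega)
    _ ≤ _ := by gcongr

/-- The bound for the increments of a chain at level `s`, for the weights `w`. -/
noncomputable def chainIncrement (w : ℕ → ℝ) (s : ℕ) : ℝ :=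
  ∑ r ∈ Finset.range (s + 1), (1 / 2) ^ (s - r) * (√2 ^ r * w (2 ^ r - 1))

theorem chainIncrement_pos {w : ℕ → ℝ} (hw : ∀ j, 0 ≤ w j) (h0 : 0 < w 0) (s : ℕ) :
    0 < chainIncrement w s := by
  refine Finset.sum_pos' (fun r _ => ?_) ⟨0, by simp, ?_⟩
  · have := hw (2 ^ r - 1); positivity
  · simpa using h0

/-- Block `r` has at most `2 ^ r` coordinates, each of weight at most that of its first index `2 ^ r
- 1`; a sum of squares is then at most the square of the sum. -/
theorem sum_weight_sq_le {w : ℕ → ℝ} (hw : ∀ j, 0 ≤ w j) (hanti : Antitone w) (s : ℕ) :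
    ∑ j : Fin n, w j ^ 2 *
      (if dyadicBlock j ≤ s then (1 / 2 : ℝ) ^ (s - dyadicBlock j) else 0) ^ 2
      ≤ chainIncrement w s ^ 2 := by
  calc _ ≤ ∑ j : Fin n, ∑ r ∈ Finset.range (s + 1),
        if dyadicBlock j = r then (w (2 ^ r - 1) * (1 / 2) ^ (s - r)) ^ 2 else 0 := by
        refine Finset.sum_le_sum fun j _ => ?_
        rw [Finset.sum_ite_eq, ← mul_pow]
        by_cases h : dyadicBlock j ≤ s
        · rw [if_pos h, if_pos (Finset.mem_range.2 (by omega))]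
          have h1 : 2 ^ dyadicBlock j ≤ (j : ℕ) + 1 := (dyadicBlock_eq_iff.1 rfl).1
          have h2 : w j ≤ w (2 ^ dyadicBlock j - 1) := hanti (by omega)
          have := hw j
          gcongr
        · rw [if_neg h, if_neg (by simpa using h)]
          simp
    _ = ∑ r ∈ Finset.range (s + 1),
        ((Finset.univ.filter fun j : Fin n => dyadicBlock j = r).card : ℝ)
          * (w (2 ^ r - 1) * (1 / 2) ^ (s - r)) ^ 2 := by
        rw [Finset.sum_comm]
        refine Finset.sum_congr rfl fun r _ => ?_
        rw [← Finset.sum_filter, Finset.sum_const, nsmul_eq_mul]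
    _ ≤ ∑ r ∈ Finset.range (s + 1), ((1 / 2) ^ (s - r) * (√2 ^ r * w (2 ^ r - 1))) ^ 2 := by
        refine Finset.sum_le_sum fun r _ => ?_
        have h1 : ((Finset.univ.filter fun j : Fin n => dyadicBlock j = r).card : ℝ)
            ≤ 2 ^ r := by exact_mod_cast card_dyadicBlock_eq_le r
        have h2 : (√2 ^ r) ^ 2 = (2 : ℝ) ^ r := by
          rw [← pow_mul, mul_comm, pow_mul, Real.sq_sqrt zero_le_two]
        calc _ ≤ 2 ^ r * (w (2 ^ r - 1) * (1 / 2) ^ (s - r)) ^ 2 := by gcongr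
          _ = _ := by rw [← h2]; ring
    _ ≤ _ := by
        refine Finset.sum_sq_le_sq_sum_of_nonneg fun r _ => ?_
        have := hw (2 ^ r - 1)
        positivity

/-- Cauchy condensation, shifted by one because coordinates are counted from `0`. -/
theorem sum_condensed_weight_le {w : ℕ → ℝ} (hw : ∀ j, 0 ≤ w j) (hanti : Antitone w)
    (hn : ∀ j, n ≤ j → w j = 0) (T : ℕ) :
    ∑ r ∈ Finset.range T, 2 ^ r * w (2 ^ r - 1) ≤ 2 * ∑ j : Fin n, w j := by
  have h1 := Finset.sum_condensed_le (f := fun k => w (k - 1))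
    (fun i j _ hij => hanti (by omega)) T
  have h2 : ∑ r ∈ Finset.range T, 2 ^ r * w (2 ^ r - 1)
      ≤ ∑ r ∈ Finset.range (T + 1), 2 ^ r • w (2 ^ r - 1) := by
    rw [Finset.sum_range_succ]
    have := hw (2 ^ T - 1)
    simp only [nsmul_eq_mul, Nat.cast_pow, Nat.cast_ofNat]
    linarith [mul_nonneg (pow_nonneg zero_le_two T : (0 : ℝ) ≤ 2 ^ T) this]
  have h3 : w 0 + ∑ k ∈ Finset.Ico 2 (2 ^ T + 1), w (k - 1) = ∑ j ∈ Finset.range (2 ^ T), w j := by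
    rw [Finset.range_eq_Ico, Finset.sum_eq_sum_Ico_succ_bot (Nat.two_pow_pos T)]
    congr 1
    rw [Finset.sum_Ico_eq_sum_range, Finset.sum_Ico_eq_sum_range]
    exact Finset.sum_congr rfl fun i _ => by congr 1; omega
  have h4 : ∑ j ∈ Finset.range (2 ^ T), w j ≤ ∑ j ∈ Finset.range n, w j := by
    calc _ ≤ ∑ j ∈ Finset.range (2 ^ T + n), w j :=
          Finset.sum_le_sum_of_subset_of_nonneg (by simp) fun _ _ _ => hw _
      _ = _ := by
          symm
          refine Finset.sum_subset (by simp) fun j _ hj => hn j (by simpa using hj)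
  rw [Finset.sum_range (n := n)] at h4
  rw [nsmul_eq_mul] at h1
  simp only [Nat.sub_self, Nat.cast_ofNat] at h1
  have := hw 0
  linarith

/-- The contribution of block `r` to level `s` is `(√2 / 2) ^ (s - r) * 2 ^ r * w (2 ^ r - 1)`.
Summing over `s ≥ r` first costs a factor `4`, since `√2 / 2 ≤ 3/4`; condensation costs another `2`.
-/
theorem sum_chainIncrement_le {w : ℕ → ℝ} (hw : ∀ j, 0 ≤ w j) (hanti : Antitone w)
    (hn : ∀ j, n ≤ j → w j = 0) (T : ℕ) :
    ∑ s ∈ Finset.range T, √2 ^ s * chainIncrement w s ≤ 8 * ∑ j : Fin n, w j := by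
  have hs : √2 * √2 = 2 := Real.mul_self_sqrt zero_le_two
  have hs0 : 0 ≤ √2 := Real.sqrt_nonneg _
  have hs2 : √2 / 2 ≤ 3 / 4 := by nlinarith
  have key : ∀ s r, r ≤ s → √2 ^ s * ((1 / 2) ^ (s - r) * (√2 ^ r * w (2 ^ r - 1)))
      ≤ (3 / 4) ^ (s - r) * (2 ^ r * w (2 ^ r - 1)) := by
    intro s r hrs
    obtain ⟨u, rfl⟩ := Nat.exists_eq_add_of_le hrs
    rw [Nat.add_sub_cancel_left]
    have := hw (2 ^ r - 1)
    calc _ = (√2 / 2) ^ u * ((√2 * √2) ^ r * w (2 ^ r - 1)) := by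
          rw [pow_add, div_pow, mul_pow, div_pow, one_pow]; ring
      _ ≤ _ := by rw [hs]; gcongr
  have geom : ∀ k : ℕ, ∑ u ∈ Finset.range k, (3 / 4 : ℝ) ^ u ≤ 4 := by
    intro k
    rw [geom_sum_eq (by norm_num), div_le_iff_of_neg (by norm_num)]
    have : (0 : ℝ) < (3 / 4) ^ k := by positivity
    linarith
  calc _ ≤ ∑ s ∈ Finset.range T, ∑ r ∈ Finset.range (s + 1),
        (3 / 4 : ℝ) ^ (s - r) * (2 ^ r * w (2 ^ r - 1)) := by
        refine Finset.sum_le_sum fun s _ => ?_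
        rw [chainIncrement, Finset.mul_sum]
        exact Finset.sum_le_sum fun r hr => key s r (by simpa [Nat.lt_succ_iff] using hr)
    _ = ∑ r ∈ Finset.range T, ∑ s ∈ Finset.Ico r T,
        (3 / 4 : ℝ) ^ (s - r) * (2 ^ r * w (2 ^ r - 1)) := by
        refine Finset.sum_comm' fun s r => ?_
        simp only [Finset.mem_range, Finset.mem_Ico]; omega
    _ ≤ ∑ r ∈ Finset.range T, 4 * (2 ^ r * w (2 ^ r - 1)) := by
        refine Finset.sum_le_sum fun r _ => ?_
        rw [← Finset.sum_mul]
        have := hw (2 ^ r - 1)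
        refine mul_le_mul_of_nonneg_right ?_ (by positivity)
        rw [Finset.sum_Ico_eq_sum_range]
        simpa using geom (T - r)
    _ ≤ _ := by
        rw [← Finset.mul_sum]
        linarith [sum_condensed_weight_le hw hanti hn T]

/-- The coefficient `c m * exp (2 π i ∑ a m j * x j)` of a generalized polynomial on the torus. -/
noncomputable def torusCoeff (c : ℕ → ℝ) (a : ℕ → Fin n → ℕ) (x : Fin n → ℝ) (m : ℕ) : ℂ :=
  c m * Complex.exp (Complex.I * ((2 * Real.pi * ∑ j, a m j * x j : ℝ) : ℂ))

theorem norm_torusCoeff_zero (c : ℕ → ℝ) (a : ℕ → Fin n → ℕ) (m : ℕ) :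
    ‖torusCoeff c a 0 m‖ = |c m| := by
  simp [torusCoeff]

theorem norm_torusCoeff_sub_le {c : ℕ → ℝ} (a : ℕ → Fin n → ℕ) {x y δ : Fin n → ℝ}
    (hδ : ∀ j, |x j - y j| ≤ δ j) (m : ℕ) (hc : 0 ≤ c m) :
    ‖torusCoeff c a x m - torusCoeff c a y m‖ ≤ 2 * Real.pi * (c m * ∑ j, a m j * δ j) := by
  have e : torusCoeff c a x m - torusCoeff c a y m
      = c m * (Complex.exp (Complex.I * ((2 * Real.pi * ∑ j, a m j * y j : ℝ) : ℂ))
        * (Complex.exp (Complex.I * ((2 * Real.pi * ∑ j, a m j * (x j - y j) : ℝ) : ℂ)) - 1)) := by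
    rw [torusCoeff, torusCoeff, mul_sub_one, ← Complex.exp_add, ← mul_add, ← Complex.ofReal_add,
      ← mul_add, ← Finset.sum_add_distrib]
    simp only [add_sub_cancel, mul_sub]
  rw [e, norm_mul, norm_mul, Complex.norm_exp_I_mul_ofReal, one_mul, Complex.norm_real,
    Real.norm_of_nonneg hc]
  have h := Real.norm_exp_I_mul_ofReal_sub_one_le (x := 2 * Real.pi * ∑ j, a m j * (x j - y j))
  have h2 : ‖2 * Real.pi * ∑ j, (a m j : ℝ) * (x j - y j)‖
      ≤ 2 * Real.pi * ∑ j, a m j * δ j := by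
    rw [norm_mul, Real.norm_of_nonneg Real.two_pi_pos.le]
    refine mul_le_mul_of_nonneg_left ?_ Real.two_pi_pos.le
    refine (norm_sum_le _ _).trans (Finset.sum_le_sum fun j _ => ?_)
    rw [norm_mul, Real.norm_of_nonneg (Nat.cast_nonneg _)]
    exact mul_le_mul_of_nonneg_left (hδ j) (Nat.cast_nonneg _)
  calc _ ≤ c m * (2 * Real.pi * ∑ j, a m j * δ j) :=
        mul_le_mul_of_nonneg_left (h.trans h2) hc
    _ = _ := by ring

end Chaining

/-! ### Chaining for random polynomials on the torus. -/

namespace IsRademacherSeq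

variable {Ω : Type*} [MeasurableSpace Ω] {P : Measure Ω} {ε : ℕ → Ω → ℝ}

/-- The increments between consecutive levels of the chain. -/
theorem exists_integrable_bound_level [IsProbabilityMeasure P] (h : IsRademacherSeq ε P)
    (S : Finset ℕ) (hS : ∀ m ∈ S, 1 ≤ m) {n : ℕ} {c : ℕ → ℝ} (hc : ∀ m, 0 ≤ c m)
    (a : ℕ → Fin n → ℕ) {w : ℕ → ℝ} (hw : ∀ j, 0 ≤ w j) (hanti : Antitone w) (hw0 : 0 < w 0)
    {M : ℝ} (hM0 : 0 < M)
    (hM : ∀ δ : Fin n → ℝ, ∑ m ∈ S, (c m * ∑ j, a m j * δ j) ^ 2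
      ≤ M ^ 2 * ∑ j : Fin n, w j ^ 2 * δ j ^ 2) (s : ℕ) :
    ∃ Z : Ω → ℝ, Integrable Z P ∧
      ∫ ω, Z ω ∂P ≤ 18 * Real.pi * M * (√2 ^ s * chainIncrement w s) ∧
      ∀ ω, ∀ x ∈ levelGrid n (s + 1), ‖∑ m ∈ S, (ε m ω : ℂ) *
        (torusCoeff c a x m - torusCoeff c a (roundLevel s x) m)‖ ≤ Z ω := by
  have hD := chainIncrement_pos hw hw0 s
  have hv : ∀ x ∈ levelGrid n (s + 1), ∑ m ∈ S,
      ‖torusCoeff c a x m - torusCoeff c a (roundLevel s x) m‖ ^ 2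
        ≤ (2 * Real.pi * M * chainIncrement w s) ^ 2 := by
    intro x hx
    set δ : Fin n → ℝ := fun j =>
      if dyadicBlock j ≤ s then (1 / 2) ^ (s - dyadicBlock j) else 0
    calc _ ≤ ∑ m ∈ S, (2 * Real.pi * (c m * ∑ j, a m j * δ j)) ^ 2 := by
          refine Finset.sum_le_sum fun m _ => ?_
          gcongr
          exact norm_torusCoeff_sub_le a (abs_sub_roundLevel_le_of_mem hx) m (hc m)
      _ = (2 * Real.pi) ^ 2 * ∑ m ∈ S, (c m * ∑ j, a m j * δ j) ^ 2 := by
          rw [Finset.mul_sum]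
          exact Finset.sum_congr rfl fun m _ => mul_pow _ _ _
      _ ≤ (2 * Real.pi) ^ 2 * (M ^ 2 * chainIncrement w s ^ 2) := by
          gcongr
          exact (hM δ).trans (by gcongr; exact sum_weight_sq_le hw hanti s)
      _ = _ := by ring
  obtain ⟨Z, hZ, hZi, hZb⟩ := h.exists_integrable_bound S hS (levelGrid n (s + 1))
    (fun x m => torusCoeff c a x m - torusCoeff c a (roundLevel s x) m)
    (D := 2 * Real.pi * M * chainIncrement w s) (L := 9 * 2 ^ s)
    (by have := Real.pi_pos; positivity) (by positivity) hv (two_mul_card_levelGrid_le s)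
  refine ⟨Z, hZ, hZi.trans_eq ?_, hZb⟩
  have e : √(9 * 2 ^ s) = 3 * √2 ^ s := by
    rw [Real.sqrt_eq_iff_mul_self_eq (by positivity) (by positivity)]
    calc _ = 9 * (√2 * √2) ^ s := by rw [Real.mul_self_sqrt zero_le_two]
      _ = _ := by rw [mul_pow]; ring
  rw [e]; ring

theorem exists_integrable_bound_chain [IsProbabilityMeasure P] (h : IsRademacherSeq ε P)
    (S : Finset ℕ) (hS : ∀ m ∈ S, 1 ≤ m) {n : ℕ} {c : ℕ → ℝ} (hc : ∀ m, 0 ≤ c m)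
    (a : ℕ → Fin n → ℕ) {w : ℕ → ℝ} (hw : ∀ j, 0 ≤ w j) (hanti : Antitone w) (hw0 : 0 < w 0)
    {M B : ℝ} (hM0 : 0 < M) (hB0 : 0 < B) (hB : ∑ m ∈ S, c m ^ 2 ≤ B ^ 2)
    (hM : ∀ δ : Fin n → ℝ, ∑ m ∈ S, (c m * ∑ j, a m j * δ j) ^ 2
      ≤ M ^ 2 * ∑ j : Fin n, w j ^ 2 * δ j ^ 2) (T : ℕ) :
    ∃ Z : Ω → ℝ, Integrable Z P ∧
      ∫ ω, Z ω ∂P ≤ 3 * B +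
        18 * Real.pi * M * ∑ s ∈ Finset.range T, √2 ^ s * chainIncrement w s ∧
      ∀ ω, ∀ x : Fin n → ℝ, (∀ j, x j < 1) →
        ‖∑ m ∈ S, (ε m ω : ℂ) * torusCoeff c a (roundLevel T x) m‖ ≤ Z ω := by
  induction T with
  | zero =>
    -- Level `0` rounds the whole cube to the origin, so a single sum remains, and `L = 1` suffices
    -- as `2 ≤ exp 1`.
    obtain ⟨Z, hZ, hZi, hZb⟩ := h.exists_integrable_bound S hS (Finset.univ : Finset Unit)
      (fun _ m => torusCoeff c a 0 m) hB0 one_pos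
      (by simpa [norm_torusCoeff_zero] using hB)
      (by have := Real.add_one_le_exp (1 : ℝ); norm_num at this ⊢; exact this)
    refine ⟨Z, hZ, by simpa using hZi, fun ω x hx => ?_⟩
    rw [roundLevel_zero hx]
    exact hZb ω () (Finset.mem_univ _)
  | succ T ih =>
    obtain ⟨Z, hZ, hZi, hZb⟩ := ih
    obtain ⟨Z', hZ', hZi', hZb'⟩ := h.exists_integrable_bound_level S hS hc a hw hanti hw0 hM0 hM T
    refine ⟨fun ω => Z ω + Z' ω, hZ.add hZ', ?_, fun ω x hx => ?_⟩
    · rw [integral_add hZ hZ', Finset.sum_range_succ, mul_add]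
      linarith
    · have h1 := hZb ω x hx
      have h2 := hZb' ω _ (roundLevel_mem_levelGrid (T + 1) hx)
      rw [roundLevel_roundLevel_succ] at h2
      refine le_trans ?_ (add_le_add h1 h2)
      refine le_trans (le_of_eq ?_) (norm_add_le _ _)
      rw [← Finset.sum_add_distrib]
      congr 1
      exact Finset.sum_congr rfl fun m _ => by ring

/-- A bound for the expected supremum over the torus of a random polynomial, in terms of the weights
of a box whose canonical metric dominates that of the polynomial. -/
theorem lintegral_iSup_torus_le [IsProbabilityMeasure P] (h : IsRademacherSeq ε P)
    (S : Finset ℕ) (hS : ∀ m ∈ S, 1 ≤ m) {n : ℕ} {c : ℕ → ℝ} (hc : ∀ m, 0 ≤ c m)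
    (a : ℕ → Fin n → ℕ) {w : ℕ → ℝ} (hw : ∀ j, 0 ≤ w j) (hanti : Antitone w) (hw0 : 0 < w 0)
    (hn : ∀ j, n ≤ j → w j = 0)
    {M B : ℝ} (hM0 : 0 < M) (hB0 : 0 < B) (hB : ∑ m ∈ S, c m ^ 2 ≤ B ^ 2)
    (hM : ∀ δ : Fin n → ℝ, ∑ m ∈ S, (c m * ∑ j, a m j * δ j) ^ 2
      ≤ M ^ 2 * ∑ j : Fin n, w j ^ 2 * δ j ^ 2)
    {τ : Type*} (x : τ → Fin n → ℝ) (hx : ∀ t j, x t j ∈ Set.Ico (0 : ℝ) 1) :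
    ∫⁻ ω, ⨆ t, ‖∑ m ∈ S, (ε m ω : ℂ) * torusCoeff c a (x t) m‖ₑ ∂P
      ≤ ENNReal.ofReal (4 * B + 144 * Real.pi * M * ∑ j : Fin n, w j) := by
  -- Once `|ε m| = 1`, rounding at level `T` changes the polynomial by at most `R * 2 ^ (-T)`. A
  -- large `T` makes this at most `B`, so the chain can stop after finitely many levels.
  set R : ℝ := ∑ m ∈ S, 2 * Real.pi * (c m * ∑ j, a m j * (n : ℝ)) with hR
  have hR0 : 0 ≤ R := Finset.sum_nonneg fun m _ => by
    have := hc m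
    have := Real.pi_pos
    positivity
  obtain ⟨T, hT⟩ := exists_pow_lt_of_lt_one (show 0 < B / (R + 1) by positivity)
    (show (1 / 2 : ℝ) < 1 by norm_num)
  have hRT : R * (1 / 2) ^ T ≤ B := by
    rw [lt_div_iff₀ (by positivity)] at hT
    have : (0 : ℝ) ≤ (1 / 2) ^ T := by positivity
    linarith
  obtain ⟨Z, hZ, hZi, hZb⟩ :=
    h.exists_integrable_bound_chain S hS hc a hw hanti hw0 hM0 hB0 hB hM T
  have hrem : ∀ᵐ ω ∂P, ∀ t, ‖∑ m ∈ S, (ε m ω : ℂ) * torusCoeff c a (x t) m‖ ≤ Z ω + B := by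
    filter_upwards [h.ae_forall_abs_eq_one S hS] with ω hω t
    have h1 : ‖∑ m ∈ S, (ε m ω : ℂ) *
        (torusCoeff c a (x t) m - torusCoeff c a (roundLevel T (x t)) m)‖ ≤ B := by
      refine le_trans (norm_sum_le _ _) (le_trans ?_ hRT)
      rw [hR, Finset.sum_mul]
      refine Finset.sum_le_sum fun m hm => ?_
      rw [norm_mul, Complex.norm_real, Real.norm_eq_abs, hω m hm, one_mul]
      refine (norm_torusCoeff_sub_le a (abs_sub_roundLevel_le T fun j => (hx t j).1) m
        (hc m)).trans_eq ?_
      simp only [← mul_assoc, ← Finset.sum_mul]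
    have h2 := hZb ω (x t) fun j => (hx t j).2
    refine le_trans ?_ (add_le_add h2 h1)
    refine le_trans (le_of_eq ?_) (norm_add_le _ _)
    rw [← Finset.sum_add_distrib]
    congr 1
    exact Finset.sum_congr rfl fun m _ => by ring
  have hZ0 : ∀ ω, 0 ≤ Z ω := fun ω => (norm_nonneg _).trans (hZb ω 0 fun _ => one_pos)
  calc _ ≤ ∫⁻ ω, ENNReal.ofReal (Z ω + B) ∂P := by
        refine lintegral_mono_ae ?_
        filter_upwards [hrem] with ω hω
        refine iSup_le fun t => ?_
        rw [← ofReal_norm]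
        exact ENNReal.ofReal_le_ofReal (hω t)
    _ = ENNReal.ofReal (∫ ω, (Z ω + B) ∂P) :=
        (ofReal_integral_eq_lintegral_ofReal (hZ.add (integrable_const B))
          (ae_of_all _ fun ω => add_nonneg (hZ0 ω) hB0.le)).symm
    _ ≤ _ := by
        refine ENNReal.ofReal_le_ofReal ?_
        rw [integral_add hZ (integrable_const B), integral_const, probReal_univ, one_smul]
        have h1 := sum_chainIncrement_le hw hanti hn T
        have h2 := mul_le_mul_of_nonneg_left h1
          (show 0 ≤ 18 * Real.pi * M by have := Real.pi_pos; positivity)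
        linarith

end IsRademacherSeq

/-! ### Power sums over multiples, and prime valuations. -/

theorem sum_rpow_sub_one_le {s : ℝ} (h0 : 0 < s) (h1 : s ≤ 1) (L : ℕ) :
    ∑ l ∈ Finset.Icc 1 L, (l : ℝ) ^ (s - 1) ≤ (L : ℝ) ^ s / s := by
  induction L with
  | zero => simp [Real.zero_rpow h0.ne']
  | succ L ih =>
    rw [Finset.sum_Icc_succ_top (by omega)]
    have hy : (0 : ℝ) < ((L + 1 : ℕ) : ℝ) := by positivity
    set y : ℝ := ((L + 1 : ℕ) : ℝ) with hydef
    have hy1 : (1 : ℝ) ≤ y := by rw [hydef]; exact_mod_cast Nat.succ_pos L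
    have e : (L : ℝ) = y * (1 + -y⁻¹) := by
      rw [mul_add, mul_neg, mul_inv_cancel₀ hy.ne', hydef]; push_cast; ring
    have hinv : y⁻¹ ≤ 1 := inv_le_one_of_one_le₀ hy1
    -- Bernoulli's inequality for `(1 - 1/y) ^ s`, in place of a comparison with an integral.
    have key : (L : ℝ) ^ s ≤ y ^ s - s * y ^ (s - 1) := by
      rw [e, Real.mul_rpow hy.le (by linarith), Real.rpow_sub_one hy.ne']
      have := rpow_one_add_le_one_add_mul_self (s := -y⁻¹) (by linarith) h0.le h1
      have h2 := mul_le_mul_of_nonneg_left this (Real.rpow_nonneg hy.le s)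
      refine h2.trans_eq ?_
      field_simp
      ring
    have : (L : ℝ) ^ s / s ≤ y ^ s / s - y ^ (s - 1) := by
      rw [div_le_iff₀ h0, sub_mul, div_mul_cancel₀ _ h0.ne']
      linarith
    linarith

theorem sum_dvd_rpow_sub_one_le {s : ℝ} (h0 : 0 < s) (h1 : s ≤ 1) (N : ℕ) {d : ℕ} (hd : 1 ≤ d) :
    (∑ m ∈ Finset.Icc 1 N, if d ∣ m then (m : ℝ) ^ (s - 1) else 0) ≤ (N : ℝ) ^ s / s / d := by
  have hd' : (0 : ℝ) < d := by exact_mod_cast hd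
  have e : (Finset.Icc 1 N).filter (d ∣ ·) = (Finset.Icc 1 (N / d)).image (d * ·) := by
    ext m
    simp only [Finset.mem_filter, Finset.mem_Icc, Finset.mem_image]
    constructor
    · rintro ⟨⟨h2, h3⟩, l, rfl⟩
      exact ⟨l, ⟨Nat.pos_of_mul_pos_left h2, (Nat.le_div_iff_mul_le hd).2 (by linarith)⟩, rfl⟩
    · rintro ⟨l, ⟨h2, h3⟩, rfl⟩
      have := (Nat.le_div_iff_mul_le hd).1 h3
      exact ⟨⟨Nat.mul_pos hd h2, by linarith⟩, dvd_mul_right _ _⟩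
  rw [← Finset.sum_filter, e, Finset.sum_image fun i _ j _ hij => Nat.eq_of_mul_eq_mul_left hd hij]
  calc _ = (d : ℝ) ^ (s - 1) * ∑ l ∈ Finset.Icc 1 (N / d), (l : ℝ) ^ (s - 1) := by
        rw [Finset.mul_sum]
        refine Finset.sum_congr rfl fun l _ => ?_
        push_cast
        rw [Real.mul_rpow hd'.le (Nat.cast_nonneg l)]
    _ ≤ (d : ℝ) ^ (s - 1) * ((N / d : ℝ) ^ s / s) := by
        gcongr
        refine (sum_rpow_sub_one_le h0 h1 _).trans ?_
        gcongr
        exact Nat.cast_div_le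
    _ = _ := by
        rw [Real.div_rpow (Nat.cast_nonneg N) hd'.le, Real.rpow_sub_one hd'.ne']
        have : (d : ℝ) ^ s ≠ 0 := (Real.rpow_pos_of_pos hd' s).ne'
        field_simp

theorem sum_range_ite_pow_dvd {p N m : ℕ} (hp : p.Prime) (hm : m ∈ Finset.Icc 1 N) (f : ℕ → ℝ) :
    (∑ r ∈ Finset.range N, if p ^ (r + 1) ∣ m then f r else 0)
      = ∑ r ∈ Finset.range (m.factorization p), f r := by
  rw [Finset.mem_Icc] at hm
  have hlt := Nat.factorization_lt p (n := m) (by omega)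
  rw [← Finset.sum_filter]
  refine Finset.sum_congr ?_ fun _ _ => rfl
  ext r
  simp only [Finset.mem_filter, Finset.mem_range,
    hp.pow_dvd_iff_le_factorization (show m ≠ 0 by omega)]
  omega

theorem factorization_eq_sum_range {p N m : ℕ} (hp : p.Prime) (hm : m ∈ Finset.Icc 1 N) :
    (m.factorization p : ℝ) = ∑ r ∈ Finset.range N, if p ^ (r + 1) ∣ m then (1 : ℝ) else 0 := by
  rw [sum_range_ite_pow_dvd hp hm fun _ => 1]
  simp

/-- A square is a sum of consecutive odd numbers, so second moments of a valuation reduce to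
counting multiples of prime powers. -/
theorem factorization_sq_eq_sum_range {p N m : ℕ} (hp : p.Prime) (hm : m ∈ Finset.Icc 1 N) :
    (m.factorization p : ℝ) ^ 2
      = ∑ r ∈ Finset.range N, if p ^ (r + 1) ∣ m then (2 * r + 1 : ℝ) else 0 := by
  rw [sum_range_ite_pow_dvd hp hm fun r => 2 * (r : ℝ) + 1]
  generalize m.factorization p = a
  induction a with
  | zero => simp
  | succ a ih => rw [Finset.sum_range_succ, ← ih]; push_cast; ring

theorem sum_range_inv_pow_succ_le {p : ℕ} (hp : p.Prime) (R : ℕ) :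
    ∑ r ∈ Finset.range R, 1 / (p : ℝ) ^ (r + 1) ≤ 2 / p := by
  have hp2 : (2 : ℝ) ≤ p := by exact_mod_cast hp.two_le
  have hp0 : (0 : ℝ) < p := by linarith
  have geom : ∑ r ∈ Finset.range R, (1 / 2 : ℝ) ^ r ≤ 2 := by
    rw [geom_sum_eq (by norm_num), div_le_iff_of_neg (by norm_num)]
    have : (0 : ℝ) < (1 / 2) ^ R := by positivity
    linarith
  calc _ ≤ ∑ r ∈ Finset.range R, 1 / (p : ℝ) * (1 / 2) ^ r := by
        refine Finset.sum_le_sum fun r _ => ?_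
        rw [pow_succ', one_div_pow, ← one_div_mul_one_div]
        gcongr
    _ ≤ 1 / (p : ℝ) * 2 := by rw [← Finset.mul_sum]; gcongr
    _ = _ := by ring

theorem sum_range_odd_mul_inv_pow_succ_le {p : ℕ} (hp : p.Prime) (R : ℕ) :
    ∑ r ∈ Finset.range R, (2 * r + 1) / (p : ℝ) ^ (r + 1) ≤ 6 / p := by
  have hp2 : (2 : ℝ) ≤ p := by exact_mod_cast hp.two_le
  have hp0 : (0 : ℝ) < p := by linarith
  have geom : ∀ R : ℕ, ∑ r ∈ Finset.range R, (2 * r + 1) * (1 / 2 : ℝ) ^ r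
      = 6 - (4 * R + 6) * (1 / 2) ^ R := by
    intro R
    induction R with
    | zero => simp
    | succ R ih => rw [Finset.sum_range_succ, ih]; push_cast; ring
  calc _ ≤ ∑ r ∈ Finset.range R, 1 / (p : ℝ) * ((2 * r + 1) * (1 / 2) ^ r) := by
        refine Finset.sum_le_sum fun r _ => ?_
        have : (2 * r + 1) / (p : ℝ) ^ (r + 1) = 1 / (p : ℝ) * ((2 * r + 1) * (1 / (p : ℝ) ^ r)) := by
          rw [pow_succ']; field_simp
        rw [this, one_div_pow]
        gcongr
    _ ≤ 1 / (p : ℝ) * 6 := by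
        rw [← Finset.mul_sum, geom]
        gcongr
        have : (0 : ℝ) ≤ (4 * R + 6) * (1 / 2) ^ R := by positivity
        linarith
    _ = _ := by ring

/-! ### The quadratic form of the valuations. -/

section QuadraticForm

variable {N : ℕ} {u : ℕ → ℝ} {Q : ℝ}

theorem sum_factorization_sq_le (hQ : 0 ≤ Q)
    (hd : ∀ d : ℕ, 1 ≤ d → (∑ m ∈ Finset.Icc 1 N, if d ∣ m then u m else 0) ≤ Q / d)
    {p : ℕ} (hp : p.Prime) :
    ∑ m ∈ Finset.Icc 1 N, u m * (m.factorization p : ℝ) ^ 2 ≤ 6 * Q / p := by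
  calc _ = ∑ r ∈ Finset.range N, (2 * r + 1) *
        ∑ m ∈ Finset.Icc 1 N, if p ^ (r + 1) ∣ m then u m else 0 := by
        simp only [Finset.mul_sum]
        rw [Finset.sum_comm]
        refine Finset.sum_congr rfl fun m hm => ?_
        rw [factorization_sq_eq_sum_range hp hm, Finset.mul_sum]
        refine Finset.sum_congr rfl fun r _ => ?_
        split_ifs <;> ring
    _ ≤ ∑ r ∈ Finset.range N, (2 * r + 1) * (Q / (p ^ (r + 1) : ℕ)) := by
        gcongr with r _
        exact hd _ (Nat.pow_pos hp.pos)
    _ = Q * ∑ r ∈ Finset.range N, (2 * r + 1) / (p : ℝ) ^ (r + 1) := by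
        rw [Finset.mul_sum]
        refine Finset.sum_congr rfl fun r _ => ?_
        push_cast; ring
    _ ≤ Q * (6 / p) := by gcongr; exact sum_range_odd_mul_inv_pow_succ_le hp N
    _ = _ := by ring

theorem sum_factorization_mul_le (hQ : 0 ≤ Q)
    (hd : ∀ d : ℕ, 1 ≤ d → (∑ m ∈ Finset.Icc 1 N, if d ∣ m then u m else 0) ≤ Q / d)
    {p q : ℕ} (hp : p.Prime) (hq : q.Prime) (hpq : p ≠ q) :
    ∑ m ∈ Finset.Icc 1 N, u m * ((m.factorization p : ℝ) * m.factorization q)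
      ≤ 4 * Q * (1 / p * (1 / q)) := by
  calc _ = ∑ r ∈ Finset.range N, ∑ k ∈ Finset.range N,
        ∑ m ∈ Finset.Icc 1 N, if p ^ (r + 1) * q ^ (k + 1) ∣ m then u m else 0 := by
        rw [Finset.sum_congr rfl fun r _ => Finset.sum_comm, Finset.sum_comm]
        refine Finset.sum_congr rfl fun m hm => ?_
        rw [factorization_eq_sum_range hp hm, factorization_eq_sum_range hq hm,
          Finset.sum_mul_sum, Finset.mul_sum]
        refine Finset.sum_congr rfl fun r _ => ?_
        rw [Finset.mul_sum]
        refine Finset.sum_congr rfl fun k _ => ?_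
        have hco : Nat.Coprime (p ^ (r + 1)) (q ^ (k + 1)) :=
          Nat.Coprime.pow _ _ ((Nat.coprime_primes hp hq).2 hpq)
        have : p ^ (r + 1) * q ^ (k + 1) ∣ m ↔ p ^ (r + 1) ∣ m ∧ q ^ (k + 1) ∣ m :=
          ⟨fun h => ⟨dvd_of_mul_right_dvd h, dvd_of_mul_left_dvd h⟩,
            fun h => hco.mul_dvd_of_dvd_of_dvd h.1 h.2⟩
        simp only [this]
        by_cases h1 : p ^ (r + 1) ∣ m <;> by_cases h2 : q ^ (k + 1) ∣ m <;> simp [h1, h2]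
    _ ≤ ∑ r ∈ Finset.range N, ∑ k ∈ Finset.range N,
        Q / (p ^ (r + 1) * q ^ (k + 1) : ℕ) := by
        gcongr with r _ k _
        exact hd _ (Nat.mul_pos (Nat.pow_pos hp.pos) (Nat.pow_pos hq.pos))
    _ = Q * ((∑ r ∈ Finset.range N, 1 / (p : ℝ) ^ (r + 1)) *
          ∑ k ∈ Finset.range N, 1 / (q : ℝ) ^ (k + 1)) := by
        rw [Finset.sum_mul_sum, Finset.mul_sum]
        refine Finset.sum_congr rfl fun r _ => ?_
        rw [Finset.mul_sum]
        refine Finset.sum_congr rfl fun k _ => ?_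
        push_cast
        rw [one_div_mul_one_div, mul_one_div]
    _ ≤ Q * (2 / p * (2 / q)) := by
        gcongr
        · exact sum_range_inv_pow_succ_le hp N
        · exact sum_range_inv_pow_succ_le hq N
    _ = _ := by ring

/-- Off the diagonal the moments are bounded by the rank-one form `4Q / (p_i p_j)`, which
Cauchy-Schwarz turns into the factor `∑ 1/p_j`. The diagonal excess `6Q / p_i` needs only the factor
`1`, hence the maximum. -/
theorem sum_sq_sum_factorization_le (hu : ∀ m, 0 ≤ u m) (hQ : 0 ≤ Q)
    (hd : ∀ d : ℕ, 1 ≤ d → (∑ m ∈ Finset.Icc 1 N, if d ∣ m then u m else 0) ≤ Q / d)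
    {n : ℕ} {p : Fin n → ℕ} (hp : ∀ j, (p j).Prime) (hinj : Function.Injective p)
    (δ : Fin n → ℝ) :
    ∑ m ∈ Finset.Icc 1 N, u m * (∑ j, (m.factorization (p j) : ℝ) * δ j) ^ 2
      ≤ 10 * Q * max 1 (∑ j, 1 / (p j : ℝ)) * ∑ j, 1 / (p j : ℝ) * δ j ^ 2 := by
  have hA : ∀ i j, ∑ m ∈ Finset.Icc 1 N,
      u m * ((m.factorization (p i) : ℝ) * m.factorization (p j))
      ≤ 4 * Q * (1 / (p i : ℝ) * (1 / p j)) + if i = j then 6 * Q / (p i : ℝ) else 0 := by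
    intro i j
    split_ifs with h
    · subst h
      have h1 := sum_factorization_sq_le hQ hd (hp i)
      have h2 : 0 ≤ 4 * Q * (1 / (p i : ℝ) * (1 / p i)) := by positivity
      simp only [← sq (Nat.cast _ : ℝ)]
      linarith
    · rw [add_zero]
      exact sum_factorization_mul_le hQ hd (hp i) (hp j) fun e => h (hinj e)
  have hCS : (∑ j, 1 / (p j : ℝ) * |δ j|) ^ 2
      ≤ (∑ j, 1 / (p j : ℝ)) * ∑ j, 1 / (p j : ℝ) * δ j ^ 2 :=
    Finset.sum_sq_le_sum_mul_sum_of_sq_le_mul _ (fun _ _ => by positivity)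
      (fun _ _ => by positivity) fun j _ => le_of_eq (by rw [mul_pow, sq_abs]; ring)
  have hpos : 0 ≤ ∑ j, 1 / (p j : ℝ) * δ j ^ 2 := Finset.sum_nonneg fun _ _ => by positivity
  calc _ ≤ ∑ m ∈ Finset.Icc 1 N, u m * (∑ j, (m.factorization (p j) : ℝ) * |δ j|) ^ 2 := by
        refine Finset.sum_le_sum fun m _ => mul_le_mul_of_nonneg_left ?_ (hu m)
        rw [← sq_abs]
        gcongr
        refine (Finset.abs_sum_le_sum_abs _ _).trans_eq ?_
        exact Finset.sum_congr rfl fun j _ => by rw [abs_mul, Nat.abs_cast]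
    _ = ∑ i, ∑ j, |δ i| * |δ j| * ∑ m ∈ Finset.Icc 1 N,
          u m * ((m.factorization (p i) : ℝ) * m.factorization (p j)) := by
        simp only [Finset.mul_sum]
        rw [Finset.sum_congr rfl fun r _ => Finset.sum_comm, Finset.sum_comm]
        refine Finset.sum_congr rfl fun m _ => ?_
        rw [sq, Finset.sum_mul_sum, Finset.mul_sum]
        refine Finset.sum_congr rfl fun i _ => ?_
        rw [Finset.mul_sum]
        exact Finset.sum_congr rfl fun j _ => by ring
    _ ≤ ∑ i, ∑ j, |δ i| * |δ j| *
          (4 * Q * (1 / (p i : ℝ) * (1 / p j)) + if i = j then 6 * Q / (p i : ℝ) else 0) := by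
        gcongr with i _ j _
        exact hA i j
    _ = 4 * Q * (∑ j, 1 / (p j : ℝ) * |δ j|) ^ 2 + 6 * Q * ∑ j, 1 / (p j : ℝ) * δ j ^ 2 := by
        rw [sq, Finset.sum_mul_sum, Finset.mul_sum, Finset.mul_sum, ← Finset.sum_add_distrib]
        refine Finset.sum_congr rfl fun i _ => ?_
        simp only [mul_add, mul_ite, mul_zero, Finset.sum_add_distrib, Finset.sum_ite_eq,
          Finset.mem_univ, if_true, Finset.mul_sum]
        congr 1
        · exact Finset.sum_congr rfl fun j _ => by ring
        · rw [← sq, sq_abs]; ring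
    _ ≤ 4 * Q * (max 1 (∑ j, 1 / (p j : ℝ)) * ∑ j, 1 / (p j : ℝ) * δ j ^ 2)
          + 6 * Q * (max 1 (∑ j, 1 / (p j : ℝ)) * ∑ j, 1 / (p j : ℝ) * δ j ^ 2) := by
        gcongr
        · exact hCS.trans (by gcongr; exact le_max_right _ _)
        · exact le_mul_of_one_le_left hpos (le_max_left _ _)
    _ = _ := by ring

end QuadraticForm

/-! ### The free primes and Bohr's lift. -/

theorem prime_nthPrime (k : ℕ) : (nthPrime k).Prime := Nat.prime_nth_prime _

theorem nthPrime_injOn : Set.InjOn nthPrime {k | 1 ≤ k} := by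
  intro i (hi : 1 ≤ i) j (hj : 1 ≤ j) hij
  have := Nat.nth_injective Nat.infinite_setOfPred_prime hij
  omega

theorem mem_image_nthPrime_freeIndices {N ν K m q : ℕ} (hν : 1 ≤ ν)
    (hK : ∀ p : ℕ, p.Prime → nthPrime ν < p → p ≤ N → p ∣ K)
    (hm : m ∈ coprimeSupport N K) (hq : q.Prime) (hqm : q ∣ m) :
    q ∈ (freeIndices ν K).image nthPrime := by
  obtain ⟨hm1, hm2⟩ := Finset.mem_filter.1 hm
  rw [Finset.mem_Icc] at hm1
  have hqK : ¬ q ∣ K := fun h => hq.one_lt.ne' (Nat.dvd_one.1 (hm2 ▸ Nat.dvd_gcd hqm h))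
  have hqN : q ≤ N := (Nat.le_of_dvd (by omega) hqm).trans hm1.2
  have hle : q ≤ nthPrime ν := by
    by_contra hlt
    exact hqK (hK q hq (not_le.1 hlt) hqN)
  have e : nthPrime (Nat.count Nat.Prime q + 1) = q := Nat.nth_count hq
  refine Finset.mem_image.2 ⟨Nat.count Nat.Prime q + 1, ?_, e⟩
  refine Finset.mem_filter.2 ⟨Finset.mem_Icc.2 ⟨by omega, ?_⟩, by rwa [e]⟩
  by_contra hlt
  have : nthPrime ν < q := by
    rw [← e]
    exact Nat.nth_strictMono Nat.infinite_setOfPred_prime (by omega)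
  omega

theorem log_eq_sum_factorization {n : ℕ} {p : Fin n → ℕ} (hp : ∀ j, (p j).Prime)
    (hinj : Function.Injective p) {m : ℕ} (hm : m ≠ 0)
    (hfac : ∀ q : ℕ, q.Prime → q ∣ m → ∃ j, p j = q) :
    Real.log m = ∑ j, (m.factorization (p j) : ℝ) * Real.log (p j) := by
  have e : m = ∏ j, p j ^ m.factorization (p j) := by
    conv_lhs => rw [← Nat.prod_factorization_pow_eq_self hm]
    rw [Finsupp.prod_of_support_subset (s := Finset.univ.image p) _ ?_ _ fun _ _ => pow_zero _,
      Finset.prod_image fun i _ j _ h => hinj h]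
    intro q hq
    obtain ⟨j, hj⟩ := hfac q (Nat.prime_of_mem_primeFactors hq) (Nat.dvd_of_mem_primeFactors hq)
    exact Finset.mem_image.2 ⟨j, Finset.mem_univ _, hj⟩
  conv_lhs => rw [e]
  push_cast
  rw [Real.log_prod fun j _ => by have := (hp j).pos; positivity]
  exact Finset.sum_congr rfl fun j _ => Real.log_pow _ _

/-- Valuations are integers, so taking fractional parts changes the phase by an integer multiple of
`2π`. -/
theorem natCast_cpow_eq_torusCoeff {n : ℕ} {p : Fin n → ℕ} (hp : ∀ j, (p j).Prime)
    (hinj : Function.Injective p) {m : ℕ} (hm : m ≠ 0)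
    (hfac : ∀ q : ℕ, q.Prime → q ∣ m → ∃ j, p j = q) (σ t : ℝ) :
    (m : ℂ) ^ (-((σ : ℂ) + (t : ℂ) * Complex.I))
      = torusCoeff (fun m => (m : ℝ) ^ (-σ)) (fun m j => m.factorization (p j))
        (fun j => Int.fract (-t * Real.log (p j) / (2 * Real.pi))) m := by
  set y : Fin n → ℝ := fun j => -t * Real.log (p j) / (2 * Real.pi) with hy
  have hm0 : (m : ℂ) ≠ 0 := Nat.cast_ne_zero.2 hm
  have hlog := log_eq_sum_factorization hp hinj hm hfac
  have e1 : 2 * Real.pi * ∑ j, (m.factorization (p j) : ℝ) * Int.fract (y j)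
      = -t * Real.log m
        - 2 * Real.pi * ((∑ j, (m.factorization (p j) : ℤ) * ⌊y j⌋ : ℤ) : ℝ) := by
    have hpi := Real.pi_ne_zero
    rw [hlog]
    push_cast
    rw [Finset.mul_sum, Finset.mul_sum, Finset.mul_sum, ← Finset.sum_sub_distrib]
    refine Finset.sum_congr rfl fun j _ => ?_
    rw [Int.fract, hy]
    field_simp
  have e2 : (m : ℂ) ^ (-(σ : ℂ)) = (((m : ℝ) ^ (-σ) : ℝ) : ℂ) := by
    rw [Complex.ofReal_cpow (Nat.cast_nonneg m)]
    push_cast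
    rfl
  rw [torusCoeff, e1, neg_add, Complex.cpow_add _ _ hm0, e2]
  congr 1
  rw [Complex.cpow_def_of_ne_zero hm0, ← Complex.natCast_log]
  generalize (∑ j, (m.factorization (p j) : ℤ) * ⌊y j⌋ : ℤ) = k
  have e3 : Complex.I * ((-t * Real.log m - 2 * Real.pi * (k : ℝ) : ℝ) : ℂ)
      = (Real.log m : ℂ) * -((t : ℂ) * Complex.I) - k * (2 * Real.pi * Complex.I) := by
    push_cast; ring
  rw [e3, Complex.exp_sub, Complex.exp_int_mul_two_pi_mul_I, div_one]

/-! ### Assembly of the bound. -/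

/-- The expected supremum of a random Dirichlet polynomial, bounded in terms of the
primes `p 0 < p 1 < ⋯` that may divide the integers in its support. -/
theorem lintegral_iSup_dirichletPoly_le {σ : ℝ} (hσ0 : 0 ≤ σ) (hσ : σ < 1 / 2) {Ω : Type*}
    [MeasurableSpace Ω] {P : Measure Ω} [IsProbabilityMeasure P] {ε : ℕ → Ω → ℝ}
    (h : IsRademacherSeq ε P) {N K n : ℕ} (hn : 0 < n) {p : Fin n → ℕ} (hp : ∀ j, (p j).Prime)
    (hmono : StrictMono p) (hN : 0 < N)
    (hfac : ∀ m ∈ coprimeSupport N K, ∀ q : ℕ, q.Prime → q ∣ m → ∃ j, p j = q) :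
    ∫⁻ ω, ⨆ t : ℝ, ‖dirichletPoly (fun n => ε n ω) N K ((σ : ℂ) + (t : ℂ) * Complex.I)‖ₑ ∂P
      ≤ ENNReal.ofReal (2308 / √(1 - 2 * σ) * (N : ℝ) ^ (1 / 2 - σ)
          * √(max 1 (∑ j, 1 / (p j : ℝ))) * ∑ j, 1 / √(p j : ℝ)) := by
  set s : ℝ := 1 - 2 * σ with hs
  have hs0 : 0 < s := by linarith
  set u : ℕ → ℝ := fun m => (m : ℝ) ^ (s - 1) with hu
  have hu0 : ∀ m, 0 ≤ u m := fun m => Real.rpow_nonneg (Nat.cast_nonneg m) _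
  set Q : ℝ := (N : ℝ) ^ s / s with hQ
  have hN' : (0 : ℝ) < N := by exact_mod_cast hN
  have hQ0 : 0 < Q := by positivity
  have hd : ∀ d : ℕ, 1 ≤ d → (∑ m ∈ Finset.Icc 1 N, if d ∣ m then u m else 0) ≤ Q / d :=
    fun d hd => sum_dvd_rpow_sub_one_le hs0 (by linarith) N hd
  have hp0 : ∀ j, (0 : ℝ) < p j := fun j => by exact_mod_cast (hp j).pos
  set S := coprimeSupport N K with hS
  have hmem : ∀ m ∈ S, 2 ≤ m ∧ m ≤ N := fun m hm => Finset.mem_Icc.1 (Finset.mem_filter.1 hm).1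
  have hsub : S ⊆ Finset.Icc 1 N := fun m hm => by
    have := hmem m hm
    exact Finset.mem_Icc.2 ⟨by omega, this.2⟩
  set c : ℕ → ℝ := fun m => (m : ℝ) ^ (-σ) with hc
  have hc0 : ∀ m, 0 ≤ c m := fun m => Real.rpow_nonneg (Nat.cast_nonneg m) _
  have hcu : ∀ m, c m ^ 2 = u m := fun m => by
    rw [hc, hu, ← Real.rpow_natCast, ← Real.rpow_mul (Nat.cast_nonneg m)]
    congr 1
    rw [hs]; push_cast; ring
  set w : ℕ → ℝ := fun j => if hj : j < n then 1 / √(p ⟨j, hj⟩ : ℝ) else 0 with hw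
  have hwj : ∀ j : Fin n, w j = 1 / √(p j : ℝ) := fun j => by simp [hw]
  have hwj2 : ∀ j : Fin n, w j ^ 2 = 1 / (p j : ℝ) := fun j => by
    rw [hwj, div_pow, one_pow, Real.sq_sqrt (hp0 j).le]
  have hw0 : ∀ j, 0 ≤ w j := fun j => by
    simp only [hw]; split_ifs <;> positivity
  have hanti : Antitone w := by
    intro i j hij
    by_cases hj : j < n
    · have hi : i < n := lt_of_le_of_lt hij hj
      simp only [hw, dif_pos hj, dif_pos hi]
      have h1 := hp0 ⟨i, hi⟩
      have h2 : (p ⟨i, hi⟩ : ℝ) ≤ p ⟨j, hj⟩ := by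
        exact_mod_cast hmono.monotone (Fin.mk_le_mk.2 hij)
      gcongr
    · have : w j = 0 := by simp [hw, hj]
      rw [this]
      exact hw0 i
  have hw00 : 0 < w 0 := by
    have := hp0 ⟨0, hn⟩
    rw [hwj ⟨0, hn⟩]
    positivity
  set V : ℝ := ∑ j : Fin n, w j with hV
  have hV0 : 0 < V := hw00.trans_le
    (Finset.single_le_sum (f := fun j : Fin n => w j) (fun j _ => hw0 j)
      (Finset.mem_univ (⟨0, hn⟩ : Fin n)))
  set X : ℝ := max 1 (∑ j, 1 / (p j : ℝ)) with hX
  have hX1 : 1 ≤ X := le_max_left _ _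
  -- Excluding `m = 1` matters here: each `m ≥ 2` in the support is a multiple of some `p j`, so the
  -- sum is at most `Q * ∑ 1 / p j`, which never exceeds `Q * V ^ 2`.
  have hB : ∑ m ∈ S, c m ^ 2 ≤ (√Q * V) ^ 2 := by
    calc ∑ m ∈ S, c m ^ 2 ≤ ∑ m ∈ S, ∑ j, if p j ∣ m then u m else 0 := by
          refine Finset.sum_le_sum fun m hm => ?_
          obtain ⟨q, hq, hqm⟩ := Nat.exists_prime_and_dvd (n := m) (by have := hmem m hm; omega)
          obtain ⟨j, rfl⟩ := hfac m hm q hq hqm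
          calc c m ^ 2 = if p j ∣ m then u m else 0 := by rw [if_pos hqm, hcu]
            _ ≤ _ := Finset.single_le_sum (f := fun j => if p j ∣ m then u m else 0)
              (fun j _ => by split_ifs; exacts [hu0 m, le_rfl]) (Finset.mem_univ j)
      _ ≤ ∑ m ∈ Finset.Icc 1 N, ∑ j, if p j ∣ m then u m else 0 :=
          Finset.sum_le_sum_of_subset_of_nonneg hsub fun m _ _ => Finset.sum_nonneg fun j _ => by
            split_ifs; exacts [hu0 m, le_rfl]
      _ = ∑ j, ∑ m ∈ Finset.Icc 1 N, if p j ∣ m then u m else 0 := Finset.sum_comm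
      _ ≤ ∑ j : Fin n, Q * w j ^ 2 := Finset.sum_le_sum fun j _ => by
          rw [hwj2, mul_one_div]
          exact hd _ (hp j).one_le
      _ ≤ Q * V ^ 2 := by
          rw [← Finset.mul_sum]
          gcongr
          exact Finset.sum_sq_le_sq_sum_of_nonneg fun j _ => hw0 j
      _ = _ := by rw [mul_pow, Real.sq_sqrt hQ0.le]
  have hM : ∀ δ : Fin n → ℝ, ∑ m ∈ S, (c m * ∑ j, (m.factorization (p j) : ℝ) * δ j) ^ 2
      ≤ (√(10 * Q * X)) ^ 2 * ∑ j : Fin n, w j ^ 2 * δ j ^ 2 := by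
    intro δ
    rw [Real.sq_sqrt (by positivity)]
    simp only [mul_pow, hcu, hwj2]
    refine le_trans ?_ (sum_sq_sum_factorization_le hu0 hQ0.le hd hp hmono.injective δ)
    exact Finset.sum_le_sum_of_subset_of_nonneg hsub fun m _ _ =>
      mul_nonneg (hu0 m) (sq_nonneg _)
  have main := h.lintegral_iSup_torus_le S (fun m hm => by have := hmem m hm; omega) hc0
    (fun m j => m.factorization (p j)) hw0 hanti hw00 (fun j hj => by simp [hw, hj])
    (M := √(10 * Q * X)) (B := √Q * V) (by positivity) (by positivity) hB hM
    (fun (t : ℝ) j => Int.fract (-t * Real.log (p j) / (2 * Real.pi)))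
    fun t j => ⟨Int.fract_nonneg _, Int.fract_lt_one _⟩
  have e : ∀ ω (t : ℝ), dirichletPoly (fun n => ε n ω) N K ((σ : ℂ) + (t : ℂ) * Complex.I)
      = ∑ m ∈ S, (ε m ω : ℂ) * torusCoeff c (fun m j => m.factorization (p j))
        (fun j => Int.fract (-t * Real.log (p j) / (2 * Real.pi))) m := by
    intro ω t
    refine Finset.sum_congr rfl fun m hm => ?_
    rw [natCast_cpow_eq_torusCoeff hp hmono.injective (by have := hmem m hm; omega) (hfac m hm)]
  simp only [e]
  refine main.trans (ENNReal.ofReal_le_ofReal ?_)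
  have hQsqrt : √Q = (N : ℝ) ^ (1 / 2 - σ) / √s := by
    rw [hQ, Real.sqrt_div' _ hs0.le, Real.sqrt_eq_rpow, ← Real.rpow_mul hN'.le]
    congr 2
    rw [hs]; ring
  have hsqrt : √(10 * Q * X) ≤ 4 * (√Q * √X) := by
    rw [Real.sqrt_mul (by positivity), Real.sqrt_mul (by positivity), mul_assoc]
    gcongr
    rw [Real.sqrt_le_left (by norm_num)]
    norm_num
  have hXs : 1 ≤ √X := Real.one_le_sqrt.2 hX1
  have hVe : ∑ j, 1 / √(p j : ℝ) = V := Finset.sum_congr rfl fun j _ => (hwj j).symm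
  rw [hVe]
  -- The bounds `π ≤ 4` and `√10 ≤ 4` give `2308 = 4 + 144 * 4 * 4`.
  calc 4 * (√Q * V) + 144 * Real.pi * √(10 * Q * X) * V
      ≤ 4 * (√Q * √X * V) + 144 * 4 * (4 * (√Q * √X)) * V := by
        gcongr
        · exact le_mul_of_one_le_right (Real.sqrt_nonneg _) hXs
        · exact Real.pi_le_four
    _ = 2308 / √s * (N : ℝ) ^ (1 / 2 - σ) * √X * V := by rw [hQsqrt]; ring

theorem theorem4 (σ : ℝ) (hσ0 : 0 < σ) (hσ : σ < 1 / 2) :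
    ∃ C : ℝ, 0 < C ∧
      ∀ (Ω : Type*) [MeasurableSpace Ω] (P : Measure Ω) [IsProbabilityMeasure P]
        (ε : ℕ → Ω → ℝ), IsRademacherSeq ε P →
      ∀ N ν K : ℕ, 1 ≤ ν → ν < Nat.primeCounting N →
        (ν : ℝ) ≤ Real.sqrt ((N : ℝ) / (Real.log N * Real.log (Real.log N))) →
        Squarefree K →
        (∀ p : ℕ, p.Prime → p ∣ K → p ≤ N) →
        (∀ p : ℕ, p.Prime → nthPrime ν < p → p ≤ N → p ∣ K) →
        ∫⁻ ω, ⨆ t : ℝ, ‖dirichletPoly (fun n => ε n ω) N K ((σ : ℂ) + (t : ℂ) * Complex.I)‖ₑ ∂P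
          ≤ ENNReal.ofReal
              (C * (N : ℝ) ^ (1 / 2 - σ)
                * Real.sqrt (max 1 (∑ k ∈ freeIndices ν K, 1 / (nthPrime k : ℝ)))
                * ∑ k ∈ freeIndices ν K, 1 / Real.sqrt (nthPrime k : ℝ)) := by
  refine ⟨2308 / √(1 - 2 * σ), by
    have : 0 < 1 - 2 * σ := by linarith
    positivity, ?_⟩
  intro Ω _ P _ ε h N ν K hν hνN _ _ _ hK
  set A := (freeIndices ν K).image nthPrime with hA
  have hinj : Set.InjOn nthPrime (freeIndices ν K) := nthPrime_injOn.mono fun k hk =>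
    (Finset.mem_Icc.1 (Finset.mem_filter.1 hk).1).1
  have hsum : ∀ f : ℕ → ℝ, ∑ k ∈ freeIndices ν K, f (nthPrime k)
      = ∑ j, f (A.orderEmbOfFin rfl j) := by
    intro f
    rw [← Finset.sum_image hinj, ← hA]
    conv_lhs => rw [← Finset.image_orderEmbOfFin_univ A rfl]
    exact Finset.sum_image fun i _ j _ hij => (A.orderEmbOfFin rfl).injective hij
  have hfac : ∀ m ∈ coprimeSupport N K, ∀ q : ℕ, q.Prime → q ∣ m → q ∈ A :=
    fun m hm q hq hqm => mem_image_nthPrime_freeIndices hν hK hm hq hqm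
  -- Chaining needs a first coordinate of positive weight. With no free prime the support is empty
  -- and both sides vanish.
  rcases Nat.eq_zero_or_pos A.card with h0 | hpos
  · have hS : coprimeSupport N K = ∅ := by
      refine Finset.eq_empty_of_forall_notMem fun m hm => ?_
      have hm2 := (Finset.mem_Icc.1 (Finset.mem_filter.1 hm).1).1
      obtain ⟨q, hq, hqm⟩ := Nat.exists_prime_and_dvd (n := m) (by omega)
      have := hfac m hm q hq hqm
      rw [Finset.card_eq_zero.1 h0] at this
      exact Finset.notMem_empty _ this
    simp [dirichletPoly, hS]
  · have hN : 0 < N := by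
      rcases Nat.eq_zero_or_pos N with rfl | hN
      · simp at hνN
      · exact hN
    have := lintegral_iSup_dirichletPoly_le hσ0.le hσ h (K := K) hpos
      (p := fun j => A.orderEmbOfFin rfl j)
      (fun j => by
        obtain ⟨k, -, hk⟩ := Finset.mem_image.1 (A.orderEmbOfFin_mem rfl j)
        rw [← hk]
        exact prime_nthPrime k)
      (A.orderEmbOfFin rfl).strictMono hN
      (fun m hm q hq hqm => by
        have h1 := hfac m hm q hq hqm
        rw [← Finset.mem_coe, ← Finset.range_orderEmbOfFin A rfl] at h1
        exact h1)
    rw [hsum fun q => 1 / (q : ℝ), hsum fun q => 1 / √(q : ℝ)]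
    exact this
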